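/- Let $A$ be a simple unital $C^*$-algebra, let $G$ be a discrete group with identity $e$, and let $(\alpha,\sigma)$ be a twisted action of $G$ on $A$: maps $\alpha:G\to\mathrm{Aut}(A)$ and $\sigma:G\times G\to\mathcal U(A)$ such that for all $g,h,k\in G$ $$\alpha_g\circ\alpha_h=\mathrm{Ad}(\sigma(g,h))\circ\alpha_{gh},\qquad \sigma(g,h)\,\sigma(gh,k)=\alpha_g(\sigma(h,k))\,\sigma(g,hk),\qquad \sigma(g,e)=\sigma(e,g)=1 .$$ Assume that the action is outer, i.e. for every $g\neq e$ the automorphism $\alpha_g$ is not of the form $\mathrm{Ad}(u)$ with $u\in\mathcal U(A)$. Let $A$ be represented faithfully and unitally on a Hilbert space $K$. The reduced twisted crossed product $A\rtimes^r_{(\alpha,\sigma)}G$ is the $C^*$-algebra of operators on $\ell^2(G,K)$ generated by the operators $$(\pi_\alpha(a)\xi)(g)=\alpha_{g^{-1}}(a)\,\xi(g),\qquad (\lambda_g\xi)(h)=\sigma(h^{-1},g)\,\xi(g^{-1}h)\qquad(a\in A,\ g,h\in G),$$ and, for a subgroup $H\le G$, $A\rtimes^r_{(\alpha,\sigma)}H$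 is identified as usual with the $C^*$-subalgebra of $A\rtimes^r_{(\alpha,\sigma)}G$ generated by $\pi_\alpha(A)$ and $\{\lambda_h:h\in H\}$. Let $H\le G$ be a subgroup and write $B=A\rtimes^r_{(\alpha,\sigma)}H\subset C=A\rtimes^r_{(\alpha,\sigma)}G$. Suppose that this inclusion is irreducible, i.e. $B'\cap C=\mathbb C1$, and that there exists a conditional expectation $E:C\to B$, i.e. a positive linear $B$-bimodule map with $E|_B=\mathrm{id}_B$. Then the inclusion $B\subset C$ is regular, i.e. $C$ is generated as a $C^*$-algebra by the unitary normalizer $\{u\in\mathcal U(C): uBu^*=B\}$, if and only if $H$ is a normal subgroup of $G$. -/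

import Mathlib

open scoped ENNReal

/-! ### Discrete twisted C*-dynamical systems -/

/-- A twisted action `(α, σ)` of a discrete group `G` on a unital C*-algebra `A`, with a normalized
unitary-valued 2-cocycle `σ`. -/
structure TwistedAction (A : Type*) (G : Type*) [CStarAlgebra A] [Group G] where
  /-- the automorphisms `α g` of `A` -/
  α : G → (A ≃⋆ₐ[ℂ] A)
  /-- the unitaries `σ g h` of `A` -/
  σ : G → G → unitary A
  /-- `α_g ∘ α_h = Ad(σ(g, h)) ∘ α_{gh}` -/
  α_comp : ∀ g h a, α g (α h a) = (σ g h : A) * α (g * h) a * star (σ g h : A)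
  /-- `σ(g, h) σ(gh, k) = α_g(σ(h, k)) σ(g, hk)` -/
  cocycle : ∀ g h k,
    (σ g h : A) * (σ (g * h) k : A) = α g (σ h k : A) * (σ g (h * k) : A)
  σ_one_right : ∀ g, σ g 1 = 1
  σ_one_left : ∀ g, σ 1 g = 1

/-- The twisted action is outer: for `g ≠ 1` no unitary of `A` implements `α g`. -/
def TwistedAction.IsOuter {A : Type*} {G : Type*} [CStarAlgebra A] [Group G]
    (S : TwistedAction A G) : Prop :=
  ∀ g : G, g ≠ 1 → ¬ ∃ u : unitary A, ∀ a : A, S.α g a = (u : A) * a * star (u : A)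

theorem norm_unitary_le_one {A : Type*} [CStarAlgebra A] (u : unitary A) : ‖(u : A)‖ ≤ 1 := by
  rcases subsingleton_or_nontrivial A with _ | _
  · rw [Subsingleton.elim (u : A) 0, norm_zero]
    exact zero_le_one
  · exact (CStarRing.norm_coe_unitary u).le

/-! ### Operators on `ℓ²(G, K)` -/

section Operators

variable {G : Type*} {K : Type*} [NormedAddCommGroup K] [InnerProductSpace ℂ K]

/-- `ℓ²(G, K)`, the square-summable functions from `G` to the Hilbert space `K`. -/
abbrev EllTwo (G : Type*) (K : Type*) [NormedAddCommGroup K] [InnerProductSpace ℂ K] : Type _ :=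
  lp (fun _ : G => K) 2

theorem summable_weighted (T : G → (K →L[ℂ] K)) (c : ℝ) (hT : ∀ g, ‖T g‖ ≤ c) (e : G ≃ G)
    (ξ : EllTwo G K) :
    Summable (fun g => ‖T g (ξ (e g))‖ ^ (2 : ℝ≥0∞).toReal) ∧
      ∑' g, ‖T g (ξ (e g))‖ ^ (2 : ℝ≥0∞).toReal ≤ (c * ‖ξ‖) ^ (2 : ℝ≥0∞).toReal := by
  have hp : 0 < (2 : ℝ≥0∞).toReal := by norm_num
  have h0 := (lp.memℓp ξ).summable hp
  have h1 : Summable (fun g => c ^ 2 * ‖ξ (e g)‖ ^ (2 : ℝ≥0∞).toReal) :=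
    ((e.summable_iff (f := fun g => ‖ξ g‖ ^ (2 : ℝ≥0∞).toReal)).2 h0).mul_left _
  have hle : ∀ g, ‖T g (ξ (e g))‖ ^ (2 : ℝ≥0∞).toReal
      ≤ c ^ 2 * ‖ξ (e g)‖ ^ (2 : ℝ≥0∞).toReal := by
    intro g
    have h2 : ‖T g (ξ (e g))‖ ≤ c * ‖ξ (e g)‖ :=
      ((T g).le_opNorm _).trans (mul_le_mul_of_nonneg_right (hT g) (norm_nonneg _))
    simp only [ENNReal.toReal_ofNat, Real.rpow_ofNat]
    rw [← mul_pow]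
    exact pow_le_pow_left₀ (norm_nonneg _) h2 2
  have hs : Summable (fun g => ‖T g (ξ (e g))‖ ^ (2 : ℝ≥0∞).toReal) :=
    Summable.of_nonneg_of_le (fun g => by positivity) hle h1
  refine ⟨hs, (hs.tsum_le_tsum hle h1).trans (le_of_eq ?_)⟩
  rw [tsum_mul_left, e.tsum_eq (fun g => ‖ξ g‖ ^ (2 : ℝ≥0∞).toReal), ← lp.norm_rpow_eq_tsum hp]
  simp only [ENNReal.toReal_ofNat, Real.rpow_ofNat]
  ring

/-- The bounded operator `(W ξ)(g) = T g (ξ (e g))` on `ℓ²(G, K)`, for a family of operators `T g`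
on `K` with norms at most `c` and a permutation `e` of `G`. -/
noncomputable def weightedShift (T : G → (K →L[ℂ] K)) (c : ℝ) (hT : ∀ g, ‖T g‖ ≤ c) (e : G ≃ G) :
    EllTwo G K →L[ℂ] EllTwo G K :=
  LinearMap.mkContinuousOfExistsBound
    { toFun := fun ξ => ⟨fun g => T g (ξ (e g)), memℓp_gen (summable_weighted T c hT e ξ).1⟩
      map_add' := fun ξ η => by ext g; exact map_add (T g) _ _
      map_smul' := fun z ξ => by ext g; exact map_smul (T g) z _ }
    ⟨c ⊔ 0, fun ξ => lp.norm_le_of_tsum_le (by norm_num) (by positivity)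
      ((summable_weighted T (c ⊔ 0) (fun g => (hT g).trans le_sup_left) e ξ).2)⟩

@[simp] theorem weightedShift_apply (T : G → (K →L[ℂ] K)) (c : ℝ) (hT : ∀ g, ‖T g‖ ≤ c)
    (e : G ≃ G) (ξ : EllTwo G K) (g : G) :
    weightedShift T c hT e ξ g = T g (ξ (e g)) := rfl

end Operators

/-! ### The reduced twisted crossed product -/

namespace TwistedAction

variable {A : Type*} {G : Type*} {K : Type*} [CStarAlgebra A] [Group G]
  [NormedAddCommGroup K] [InnerProductSpace ℂ K] [CompleteSpace K]

/-- `(π_α(a) ξ)(g) = α_{g⁻¹}(a) ξ(g)`, where `A` acts on `K` through `ρ`. -/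
noncomputable def piRep (S : TwistedAction A G) (ρ : A →⋆ₐ[ℂ] (K →L[ℂ] K)) (a : A) :
    EllTwo G K →L[ℂ] EllTwo G K :=
  weightedShift (fun g => ρ (S.α g⁻¹ a)) ‖a‖
    (fun g => (NonUnitalStarAlgHom.norm_apply_le ρ _).trans
      (NonUnitalStarAlgHom.norm_apply_le (S.α g⁻¹) a))
    (Equiv.refl G)

/-- `(λ_g ξ)(h) = σ(h⁻¹, g) ξ(g⁻¹ h)`, where `A` acts on `K` through `ρ`. -/
noncomputable def lambda (S : TwistedAction A G) (ρ : A →⋆ₐ[ℂ] (K →L[ℂ] K)) (g : G) :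
    EllTwo G K →L[ℂ] EllTwo G K :=
  weightedShift (fun h => ρ (S.σ h⁻¹ g : A)) 1
    (fun h => (NonUnitalStarAlgHom.norm_apply_le ρ _).trans (norm_unitary_le_one _))
    (Equiv.mulLeft g⁻¹)

theorem piRep_apply (S : TwistedAction A G) (ρ : A →⋆ₐ[ℂ] (K →L[ℂ] K)) (a : A)
    (ξ : EllTwo G K) (g : G) : S.piRep ρ a ξ g = ρ (S.α g⁻¹ a) (ξ g) := rfl

theorem lambda_apply (S : TwistedAction A G) (ρ : A →⋆ₐ[ℂ] (K →L[ℂ] K)) (g : G)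
    (ξ : EllTwo G K) (h : G) : S.lambda ρ g ξ h = ρ (S.σ h⁻¹ g : A) (ξ (g⁻¹ * h)) := rfl

/-- The reduced twisted crossed product of `A` by `G`, for a faithful unital representation `ρ` of
`A` on a Hilbert space `K`: the C*-algebra of operators on `ℓ²(G, K)` generated by `π_α(A)` and
all the `λ_g`. -/
noncomputable def reducedCrossedProduct (S : TwistedAction A G) (ρ : A →⋆ₐ[ℂ] (K →L[ℂ] K)) :
    StarSubalgebra ℂ (EllTwo G K →L[ℂ] EllTwo G K) :=
  (StarAlgebra.adjoin ℂ (Set.range (S.piRep ρ) ∪ Set.range (S.lambda ρ))).topologicalClosure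

/-- The reduced twisted crossed product of `A` by a subgroup `H` of `G` (for the restriction of the
twisted action to `H`), as it sits in the reduced twisted crossed product by `G`: the C*-subalgebra
generated by `π_α(A)` and the `λ_h` with `h ∈ H`. -/
noncomputable def reducedCrossedProductOn (S : TwistedAction A G) (ρ : A →⋆ₐ[ℂ] (K →L[ℂ] K))
    (H : Subgroup G) : StarSubalgebra ℂ (EllTwo G K →L[ℂ] EllTwo G K) :=
  (StarAlgebra.adjoin ℂ
    (Set.range (S.piRep ρ) ∪ S.lambda ρ '' (H : Set G))).topologicalClosure

theorem reducedCrossedProductOn_le (S : TwistedAction A G) (ρ : A →⋆ₐ[ℂ] (K →L[ℂ] K))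
    (H : Subgroup G) : S.reducedCrossedProductOn ρ H ≤ S.reducedCrossedProduct ρ :=
  StarSubalgebra.topologicalClosure_mono (StarAlgebra.adjoin_mono
    (Set.union_subset_union_right _ (Set.image_subset_range _ _)))

end TwistedAction

/-! ### Inclusions of unital C*-algebras

Here `B ≤ C` are (norm closed) unital C*-subalgebras of a C*-algebra `D`. -/

section Inclusions

variable {D : Type*} [CStarAlgebra D]

/-- The unitary normalizer of `B` in `C`: the unitaries `u` of `C` with `u B u* = B`. -/
def unitaryNormalizer (B C : StarSubalgebra ℂ D) : Set D :=
  {u | u ∈ C ∧ u ∈ unitary D ∧ (fun b : D => u * b * star u) '' (B : Set D) = (B : Set D)}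

/-- The inclusion `B ⊂ C` is regular: the unitary normalizer generates `C` as a C*-algebra. -/
def IsRegularInclusion (B C : StarSubalgebra ℂ D) : Prop :=
  (StarAlgebra.adjoin ℂ (unitaryNormalizer B C)).topologicalClosure = C

/-- The inclusion `B ⊂ C` is irreducible: the relative commutant `B' ∩ C` is `ℂ 1`. -/
def IsIrreducibleInclusion (B C : StarSubalgebra ℂ D) : Prop :=
  ∀ c ∈ C, (∀ b ∈ B, b * c = c * b) → ∃ z : ℂ, c = algebraMap ℂ D z

/-- `E : C → B` is a conditional expectation: a positive linear `B`-bimodule map that restricts to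
the identity on `B`. -/
structure IsConditionalExpectation {B C : StarSubalgebra ℂ D} (hBC : B ≤ C) (E : C →ₗ[ℂ] B) :
    Prop where
  map_inclusion : ∀ b : B, E (StarSubalgebra.inclusion hBC b) = b
  map_mul_left : ∀ (b : B) (c : C), E (StarSubalgebra.inclusion hBC b * c) = b * E c
  map_mul_right : ∀ (c : C) (b : B), E (c * StarSubalgebra.inclusion hBC b) = E c * b
  /-- positive elements `c* c` of `C` are mapped to positive elements `b* b` of `B` -/
  map_positive : ∀ c : C, ∃ b : B, E (star c * c) = star b * b

end Inclusions

/-! Write `B` and `C` for the crossed products by `H` and by `G`. An element of `C` is determined by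
its Fourier coefficients in `A`, read off from the column at `1` of its operator matrix
(`exists_matrixEntry_eq`). If it commutes with `π_α(A)`, its coefficient at `g` intertwines the
identity and `α g⁻¹`. In a simple algebra a nonzero intertwiner is a multiple of a unitary, so
outerness leaves only the coefficient at `1`, a central scalar: `π_α(A)' ∩ C = ℂ1`.

Let `u` be a unitary of `C` normalizing `B`. Some `x = E(u λ_g*)` is nonzero, since otherwise `E`
would vanish on elements of `C` arbitrarily close to `1`. The bimodule property gives `u π_α(a) u* x
= x π_α(α_g(a))`, so `λ_g* x* u` commutes with `π_α(A)` and is a scalar. Hence `x` is a nonzero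
multiple of `u λ_g*`, and `u ∈ B λ_g`. Then `λ_g` also normalizes `B`, which forces `g` into the
normalizer `N` of `H`. So every such `u` lies in the crossed product by `N`, and regularity gives `N
= G`.

Conversely, for normal `H` every `λ_g` normalizes `B`, and so do the unitaries of `A`, which span
`A`. -/

theorem adjoint_weightedShift {G : Type*} {K : Type*} [NormedAddCommGroup K]
    [InnerProductSpace ℂ K] [CompleteSpace K] (T T' : G → (K →L[ℂ] K)) (c c' : ℝ)
    (hT : ∀ g, ‖T g‖ ≤ c) (hT' : ∀ g, ‖T' g‖ ≤ c') (e : G ≃ G)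
    (h : ∀ g, T' g = star (T (e.symm g))) :
    star (weightedShift T c hT e) = weightedShift T' c' hT' e.symm := by
  rw [ContinuousLinearMap.star_eq_adjoint, eq_comm, ContinuousLinearMap.eq_adjoint_iff]
  intro ξ η
  rw [lp.inner_eq_tsum, lp.inner_eq_tsum, ← e.tsum_eq]
  refine tsum_congr fun g => ?_
  rw [weightedShift_apply, weightedShift_apply, h, Equiv.symm_apply_apply,
    ContinuousLinearMap.star_eq_adjoint, ContinuousLinearMap.adjoint_inner_left]

/-! ### Covariance relations and monomials. -/

namespace TwistedAction

variable {A : Type*} {G : Type*} {K : Type*} [CStarAlgebra A] [Group G]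
  [NormedAddCommGroup K] [InnerProductSpace ℂ K] [CompleteSpace K]
  (S : TwistedAction A G) (ρ : A →⋆ₐ[ℂ] (K →L[ℂ] K))

theorem α_one (a : A) : S.α 1 a = a := by
  have h := S.α_comp 1 1 a
  rw [S.σ_one_left] at h
  simp only [mul_one, OneMemClass.coe_one, star_one, one_mul] at h
  exact (S.α 1).injective h

/-- `a ↦ π_α(a)` as a `*`-homomorphism. -/
noncomputable def piHom : A →⋆ₐ[ℂ] (EllTwo G K →L[ℂ] EllTwo G K) where
  toFun := S.piRep ρ
  map_one' := by ext ξ g; simp [piRep_apply]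
  map_mul' a b := by ext ξ g; simp [piRep_apply]
  map_zero' := by ext ξ g; simp [piRep_apply]
  map_add' a b := by ext ξ g; simp [piRep_apply]
  commutes' z := by
    ext ξ g
    simp [piRep_apply, Algebra.algebraMap_eq_smul_one]
  map_star' a := by
    refine (adjoint_weightedShift (fun g => ρ (S.α g⁻¹ a)) (fun g => ρ (S.α g⁻¹ (star a)))
      _ _ _ _ (Equiv.refl G) fun g => ?_).symm
    simp [map_star]

theorem piHom_apply (a : A) : S.piHom ρ a = S.piRep ρ a := rfl

theorem lambda_mul_piHom (g : G) (a : A) :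
    S.lambda ρ g * S.piHom ρ a = S.piHom ρ (S.α g a) * S.lambda ρ g := by
  ext ξ k
  simp only [piHom_apply, mul_apply_eq_comp, piRep_apply, lambda_apply]
  rw [← mul_apply_eq_comp, ← mul_apply_eq_comp, ← map_mul, ← map_mul,
    S.α_comp, mul_assoc, Unitary.coe_star_mul_self, mul_one, mul_inv_rev, inv_inv]

theorem lambda_mul_lambda (g h : G) :
    S.lambda ρ g * S.lambda ρ h = S.piHom ρ (S.σ g h : A) * S.lambda ρ (g * h) := by
  ext ξ k
  simp only [piHom_apply, mul_apply_eq_comp, piRep_apply, lambda_apply]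
  rw [← mul_apply_eq_comp, ← mul_apply_eq_comp, ← map_mul, ← map_mul,
    ← S.cocycle, mul_inv_rev, inv_inv, mul_inv_rev, mul_assoc]

@[simp] theorem lambda_one : S.lambda ρ 1 = 1 := by
  ext ξ k
  simp [lambda_apply, S.σ_one_right]

theorem star_lambda_mul_lambda (g : G) : star (S.lambda ρ g) * S.lambda ρ g = 1 := by
  have h : star (S.lambda ρ g) = weightedShift (fun h => ρ (star (S.σ (g * h)⁻¹ g : A))) 1
      (fun h => (NonUnitalStarAlgHom.norm_apply_le ρ _).trans
        ((norm_star _).trans_le (norm_unitary_le_one _))) (Equiv.mulLeft g⁻¹).symm :=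
    adjoint_weightedShift _ _ _ _ _ _ _ fun k => by
      rw [← map_star]
      simp
  rw [h]
  ext ξ k
  rw [mul_apply_eq_comp, weightedShift_apply, lambda_apply,
    ← mul_apply_eq_comp, ← map_mul]
  simp

/-- The cocycle relations give `λ_g` a left inverse and a right inverse, both built from `λ_{g⁻¹}`.
They agree, and the adjoint, being a left inverse, equals them. -/
theorem star_lambda (g : G) :
    star (S.lambda ρ g) = S.piHom ρ (star (S.σ g⁻¹ g : A)) * S.lambda ρ g⁻¹ := by
  have h1 : S.piHom ρ (star (S.σ g⁻¹ g : A)) * S.lambda ρ g⁻¹ * S.lambda ρ g = 1 := by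
    rw [mul_assoc, lambda_mul_lambda, ← mul_assoc, ← map_mul]
    simp
  have h2 : S.lambda ρ g * (S.lambda ρ g⁻¹ * S.piHom ρ (star (S.σ g g⁻¹ : A))) = 1 := by
    rw [← mul_assoc, lambda_mul_lambda]
    simp only [mul_inv_cancel, lambda_one, mul_one, ← map_mul]
    simp
  rw [left_inv_eq_right_inv h1 h2]
  exact left_inv_eq_right_inv (S.star_lambda_mul_lambda ρ g) h2

theorem lambda_mul_star_lambda (g : G) : S.lambda ρ g * star (S.lambda ρ g) = 1 := by
  have h2 : S.lambda ρ g * (S.lambda ρ g⁻¹ * S.piHom ρ (star (S.σ g g⁻¹ : A))) = 1 := by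
    rw [← mul_assoc, lambda_mul_lambda]
    simp only [mul_inv_cancel, lambda_one, mul_one, ← map_mul]
    simp
  rw [left_inv_eq_right_inv (S.star_lambda_mul_lambda ρ g) h2, h2]

theorem lambda_mem_unitary (g : G) :
    S.lambda ρ g ∈ unitary (EllTwo G K →L[ℂ] EllTwo G K) :=
  ⟨S.star_lambda_mul_lambda ρ g, S.lambda_mul_star_lambda ρ g⟩

theorem star_lambda_mul_piHom (g : G) (a : A) :
    star (S.lambda ρ g) * S.piHom ρ (S.α g a) = S.piHom ρ a * star (S.lambda ρ g) := by
  have h := congrArg (fun x => star (S.lambda ρ g) * x * star (S.lambda ρ g))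
    (S.lambda_mul_piHom ρ g a)
  simp only [mul_assoc, lambda_mul_star_lambda, mul_one] at h
  rw [← h, ← mul_assoc, star_lambda_mul_lambda, one_mul]

/-! ### Membership in the crossed product by a subgroup -/

theorem piHom_mem (H : Subgroup G) (a : A) : S.piHom ρ a ∈ S.reducedCrossedProductOn ρ H :=
  StarSubalgebra.le_topologicalClosure _ (StarAlgebra.subset_adjoin ℂ _ (Or.inl ⟨a, rfl⟩))

theorem lambda_mem {H : Subgroup G} {h : G} (hh : h ∈ H) :
    S.lambda ρ h ∈ S.reducedCrossedProductOn ρ H :=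
  StarSubalgebra.le_topologicalClosure _ (StarAlgebra.subset_adjoin ℂ _ (Or.inr ⟨h, hh, rfl⟩))

theorem reducedCrossedProduct_eq_top :
    S.reducedCrossedProduct ρ = S.reducedCrossedProductOn ρ ⊤ := by
  simp [reducedCrossedProduct, reducedCrossedProductOn]

theorem lambda_mem_reducedCrossedProduct (g : G) : S.lambda ρ g ∈ S.reducedCrossedProduct ρ := by
  rw [reducedCrossedProduct_eq_top]
  exact S.lambda_mem ρ trivial

theorem isClosed_reducedCrossedProductOn (H : Subgroup G) :
    IsClosed (S.reducedCrossedProductOn ρ H : Set (EllTwo G K →L[ℂ] EllTwo G K)) :=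
  StarSubalgebra.isClosed_topologicalClosure _

/-- The monomials `π_α(a) λ_h` with `h ∈ H`. -/
def monomials (H : Subgroup G) : Set (EllTwo G K →L[ℂ] EllTwo G K) :=
  {x | ∃ a : A, ∃ h ∈ H, x = S.piHom ρ a * S.lambda ρ h}

variable {S ρ} in
theorem mul_mem_monomials {H : Subgroup G} {x y : EllTwo G K →L[ℂ] EllTwo G K}
    (hx : x ∈ S.monomials ρ H) (hy : y ∈ S.monomials ρ H) : x * y ∈ S.monomials ρ H := by
  obtain ⟨a, g, hg, rfl⟩ := hx
  obtain ⟨b, h, hh, rfl⟩ := hy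
  refine ⟨a * S.α g b * (S.σ g h : A), g * h, H.mul_mem hg hh, ?_⟩
  rw [mul_assoc, ← mul_assoc (S.lambda ρ g), lambda_mul_piHom, mul_assoc, lambda_mul_lambda]
  simp only [map_mul, mul_assoc]

variable {S ρ} in
theorem star_mem_monomials {H : Subgroup G} {x : EllTwo G K →L[ℂ] EllTwo G K}
    (hx : x ∈ S.monomials ρ H) : star x ∈ S.monomials ρ H := by
  obtain ⟨a, g, hg, rfl⟩ := hx
  refine ⟨star (S.σ g⁻¹ g : A) * S.α g⁻¹ (star a), g⁻¹, H.inv_mem hg, ?_⟩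
  rw [star_mul, star_lambda, ← map_star, mul_assoc, lambda_mul_piHom, map_mul, mul_assoc]

/-- Monomials are stable under products and adjoints, so their span is already a `*`-algebra. -/
theorem adjoin_le_span_monomials (H : Subgroup G) {x : EllTwo G K →L[ℂ] EllTwo G K}
    (hx : x ∈ StarAlgebra.adjoin ℂ (Set.range (S.piRep ρ) ∪ S.lambda ρ '' (H : Set G))) :
    x ∈ Submodule.span ℂ (S.monomials ρ H) := by
  induction hx using StarAlgebra.adjoin_induction with
  | mem x hx =>
    refine Submodule.subset_span ?_
    rcases hx with ⟨a, rfl⟩ | ⟨h, hh, rfl⟩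
    · exact ⟨a, 1, H.one_mem, by simp [piHom_apply]⟩
    · exact ⟨1, h, hh, by rw [map_one, one_mul]⟩
  | algebraMap z =>
    refine Submodule.subset_span ⟨algebraMap ℂ A z, 1, H.one_mem, ?_⟩
    rw [lambda_one, mul_one]
    exact ((S.piHom ρ).toAlgHom.commutes z).symm
  | add x y _ _ hx hy => exact add_mem hx hy
  | mul x y hx' hy' hx hy =>
    clear hx' hy'
    induction hx using Submodule.span_induction with
    | zero => rw [zero_mul]; exact zero_mem _
    | add x x' _ _ h h' => rw [add_mul]; exact add_mem h h'
    | smul z x _ h => rw [smul_mul_assoc]; exact Submodule.smul_mem _ _ h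
    | mem x hx =>
      induction hy using Submodule.span_induction with
      | zero => rw [mul_zero]; exact zero_mem _
      | add y y' _ _ h h' => rw [mul_add]; exact add_mem h h'
      | smul z y _ h => rw [mul_smul_comm]; exact Submodule.smul_mem _ _ h
      | mem y hy => exact Submodule.subset_span (mul_mem_monomials hx hy)
  | star x hx' hx =>
    clear hx'
    induction hx using Submodule.span_induction with
    | zero => rw [star_zero]; exact zero_mem _
    | add x x' _ _ h h' => rw [star_add]; exact add_mem h h'
    | smul z x _ h => rw [star_smul]; exact Submodule.smul_mem _ (star z) h
    | mem x hx => exact Submodule.subset_span (star_mem_monomials hx)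

theorem mem_closure_span_monomials {H : Subgroup G} {x : EllTwo G K →L[ℂ] EllTwo G K}
    (hx : x ∈ S.reducedCrossedProductOn ρ H) :
    x ∈ closure (Submodule.span ℂ (S.monomials ρ H) : Set (EllTwo G K →L[ℂ] EllTwo G K)) :=
  closure_mono (fun _ hy => S.adjoin_le_span_monomials ρ H hy) hx

/-- The density principle used throughout: a closed linear condition need only be checked on
monomials. -/
theorem mem_of_monomial_mem {H : Subgroup G}
    (P : Submodule ℂ (EllTwo G K →L[ℂ] EllTwo G K))
    (hP : IsClosed (P : Set (EllTwo G K →L[ℂ] EllTwo G K)))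
    (h : ∀ a : A, ∀ h ∈ H, S.piHom ρ a * S.lambda ρ h ∈ P)
    {x : EllTwo G K →L[ℂ] EllTwo G K} (hx : x ∈ S.reducedCrossedProductOn ρ H) : x ∈ P := by
  refine closure_minimal ?_ hP (S.mem_closure_span_monomials ρ hx)
  refine Submodule.span_le.2 ?_
  rintro _ ⟨a, k, hk, rfl⟩
  exact h a k hk

end TwistedAction

/-! ### Central elements and intertwiners in simple C*-algebras. -/

/-- The centre of a simple ring is a field. For `z` in the spectrum, `z - x` is central and not
invertible, hence zero. -/
theorem exists_eq_algebraMap_of_central {A : Type*} [CStarAlgebra A] [IsSimpleRing A] (x : A)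
    (hx : ∀ a, a * x = x * a) : ∃ z : ℂ, x = algebraMap ℂ A z := by
  obtain ⟨z, hz⟩ := spectrum.nonempty x
  refine ⟨z, ?_⟩
  by_contra hne
  apply hz
  have hc : algebraMap ℂ A z - x ∈ Subring.center A := by
    rw [Subring.mem_center_iff]
    intro a
    rw [mul_sub, sub_mul, hx, Algebra.commutes]
  obtain ⟨y, hy⟩ := (IsSimpleRing.isField_center A).mul_inv_cancel
    (a := ⟨_, hc⟩) (fun h => hne (sub_eq_zero.1 (congrArg Subtype.val h)).symm)
  have hy1 : (algebraMap ℂ A z - x) * (y : A) = 1 := congrArg Subtype.val hy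
  have hy2 : (y : A) * (algebraMap ℂ A z - x) = 1 := by
    rw [← hy1]
    exact Subring.mem_center_iff.1 hc _
  exact ⟨⟨_, _, hy1, hy2⟩, rfl⟩

open scoped ComplexOrder in
/-- In a simple unital C*-algebra a nonzero intertwiner between the identity and an automorphism is
a multiple of a unitary, so the automorphism is inner. -/
theorem exists_unitary_of_intertwiner {A : Type*} [CStarAlgebra A] [IsSimpleRing A]
    (β : A ≃⋆ₐ[ℂ] A) (x : A) (hx0 : x ≠ 0) (hx : ∀ a, x * a = β a * x) :
    ∃ u : unitary A, ∀ a, β a = (u : A) * a * star (u : A) := by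
  -- The adjoint relation; combined with `hx` it makes both `x* x` and `x x*` central, hence scalar.
  have hx' : ∀ a, a * star x = star x * β a := fun a => by
    have h := congrArg star (hx (star a))
    simpa [star_mul, ← map_star] using h
  obtain ⟨z, hz⟩ := exists_eq_algebraMap_of_central (star x * x) fun a => by
    rw [← mul_assoc, hx', mul_assoc, ← hx, mul_assoc]
  obtain ⟨w, hw⟩ := exists_eq_algebraMap_of_central (x * star x) fun a => by
    obtain ⟨b, rfl⟩ : ∃ b, β b = a := β.surjective a
    rw [← mul_assoc, ← hx, mul_assoc, hx', mul_assoc]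
  let := CStarAlgebra.spectralOrder A
  let := CStarAlgebra.spectralOrderedRing A
  have hz' : star x * x = algebraMap ℝ A (‖x‖ ^ 2) := by
    have hm : z ∈ spectrum ℂ (star x * x) := by
      rw [hz, spectrum.scalar_eq]
      rfl
    have hz0 : 0 ≤ z := spectrum_nonneg_of_nonneg (star_mul_self_nonneg x) hm
    have hn : ‖z‖ = ‖x‖ ^ 2 := by
      rw [sq, ← CStarRing.norm_star_mul_self, hz, norm_algebraMap']
    have hzr : z = ((‖x‖ ^ 2 : ℝ) : ℂ) := by
      rw [← hn]
      exact (Complex.norm_of_nonneg' hz0).symm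
    rw [hz, hzr]
    rfl
  -- Evaluating `x x* x` in two ways shows that the two scalars agree, because `x ≠ 0`.
  have hw' : x * star x = algebraMap ℝ A (‖x‖ ^ 2) := by
    have h : x * star x * x = algebraMap ℝ A (‖x‖ ^ 2) * x := by
      rw [mul_assoc, hz', Algebra.commutes]
    have hzw : algebraMap ℂ A (w - (‖x‖ ^ 2 : ℝ)) * x = 0 := by
      rw [map_sub, sub_mul, ← hw, h, sub_eq_zero]
      rfl
    rw [← Algebra.smul_def, smul_eq_zero, or_iff_left hx0, sub_eq_zero] at hzw
    rw [hw, hzw]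
    rfl
  have hn0 : ‖x‖ ≠ 0 := norm_ne_zero_iff.2 hx0
  have hs : ‖x‖⁻¹ * ‖x‖⁻¹ * ‖x‖ ^ 2 = 1 := by field_simp
  let u : A := ‖x‖⁻¹ • x
  have hu : u ∈ unitary A := by
    constructor
    · simp only [u, star_smul, star_trivial, smul_mul_smul_comm, hz',
        Algebra.algebraMap_eq_smul_one, smul_smul, hs, one_smul]
    · simp only [u, star_smul, star_trivial, smul_mul_smul_comm, hw',
        Algebra.algebraMap_eq_smul_one, smul_smul, hs, one_smul]
  refine ⟨⟨u, hu⟩, fun a => ?_⟩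
  have h : u * a = β a * u := by simp only [u, smul_mul_assoc, mul_smul_comm, hx]
  change β a = u * a * star u
  rw [h, mul_assoc, hu.2, mul_one]

/-! ### Fourier coefficients as matrix entries. -/

open Classical in
/-- The matrix entry at `(h, k)` of an operator on `ℓ²(G, K)`, as a function of the operator. -/
noncomputable def matrixEntry {G : Type*} {K : Type*} [NormedAddCommGroup K]
    [InnerProductSpace ℂ K] (h k : G) : (EllTwo G K →L[ℂ] EllTwo G K) →L[ℂ] (K →L[ℂ] K) :=
  (ContinuousLinearMap.compL ℂ K (EllTwo G K) K (lp.evalCLM ℂ (fun _ : G => K) 2 h)) ∘L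
    ((ContinuousLinearMap.compL ℂ K (EllTwo G K) (EllTwo G K)).flip
      (lp.singleContinuousLinearMap ℂ (fun _ : G => K) 2 k))

open Classical in
theorem matrixEntry_apply {G : Type*} {K : Type*} [NormedAddCommGroup K]
    [InnerProductSpace ℂ K] (h k : G) (T : EllTwo G K →L[ℂ] EllTwo G K) (ξ : K) :
    matrixEntry h k T ξ = T (lp.single 2 k ξ) h := rfl

open Classical in
theorem ext_matrixEntry {G : Type*} {K : Type*} [NormedAddCommGroup K]
    [InnerProductSpace ℂ K] {T T' : EllTwo G K →L[ℂ] EllTwo G K}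
    (h : ∀ g k : G, matrixEntry g k T = matrixEntry g k T') : T = T' := by
  refine lp.ext_continuousLinearMap (by simp) fun k => ?_
  ext ξ g
  have := congrArg (fun f : K →L[ℂ] K => f ξ) (h g k)
  exact this

namespace TwistedAction

variable {A : Type*} {G : Type*} {K : Type*} [CStarAlgebra A] [Group G]
  [NormedAddCommGroup K] [InnerProductSpace ℂ K] [CompleteSpace K]
  (S : TwistedAction A G) (ρ : A →⋆ₐ[ℂ] (K →L[ℂ] K))

open Classical in
theorem matrixEntry_monomial (a : A) (g k : G) :
    matrixEntry (g * k) k (S.piHom ρ a * S.lambda ρ g) =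
      ρ (S.α (g * k)⁻¹ a * (S.σ (g * k)⁻¹ g : A)) := by
  ext ξ
  rw [matrixEntry_apply, mul_apply_eq_comp, piHom_apply, piRep_apply, lambda_apply, map_mul,
    mul_apply_eq_comp, inv_mul_cancel_left, lp.single_apply_self]

open Classical in
theorem matrixEntry_monomial_of_ne (a : A) {g h k : G} (hk : h ≠ g * k) :
    matrixEntry h k (S.piHom ρ a * S.lambda ρ g) = 0 := by
  ext ξ
  rw [matrixEntry_apply, mul_apply_eq_comp, piHom_apply, piRep_apply, lambda_apply,
    lp.single_apply_ne, map_zero, map_zero]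
  · rfl
  · rintro rfl
    exact hk (mul_inv_cancel_left _ _).symm

-- Since `α 1` is the identity, `π_α(a)` acts on the summand of `ℓ²(G, K)` at `1` simply as `ρ a`.
open Classical in
theorem matrixEntry_mul_piHom (T : EllTwo G K →L[ℂ] EllTwo G K) (a : A) (g : G) :
    matrixEntry g 1 (T * S.piHom ρ a) = matrixEntry g 1 T * ρ a := by
  ext ξ
  rw [mul_apply_eq_comp, matrixEntry_apply, matrixEntry_apply, mul_apply_eq_comp]
  refine congrArg (fun η => T η g) ?_
  ext k
  rw [piHom_apply, piRep_apply]
  by_cases hk : k = 1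
  · subst hk
    rw [lp.single_apply_self, lp.single_apply_self, inv_one, α_one]
  · rw [lp.single_apply_ne _ _ _ hk, lp.single_apply_ne _ _ _ hk, map_zero]

theorem matrixEntry_piHom_mul (T : EllTwo G K →L[ℂ] EllTwo G K) (a : A) (g : G) :
    matrixEntry g 1 (S.piHom ρ a * T) = ρ (S.α g⁻¹ a) * matrixEntry g 1 T := by
  ext ξ
  rw [mul_apply_eq_comp, matrixEntry_apply, matrixEntry_apply, mul_apply_eq_comp, piHom_apply,
    piRep_apply]

variable {ρ}

/-- The matrix of an element of the crossed product has entries in `A`, and its column at `1`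
determines all the others. -/
theorem exists_matrixEntry_eq (hρ : Function.Injective ρ) {T : EllTwo G K →L[ℂ] EllTwo G K}
    (hT : T ∈ S.reducedCrossedProduct ρ) (g k : G) :
    ∃ a : A, matrixEntry g 1 T = ρ a ∧
      matrixEntry (g * k) k T = ρ (star (S.σ k⁻¹ g⁻¹ : A) * S.α k⁻¹ a) := by
  let Φ : A →ₗ[ℂ] (K →L[ℂ] K) × (K →L[ℂ] K) :=
    { toFun := fun a => (ρ a, ρ (star (S.σ k⁻¹ g⁻¹ : A) * S.α k⁻¹ a))
      map_add' := fun a b => by simp [mul_add]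
      map_smul' := fun z a => by simp }
  -- The pairs of entries allowed by the statement form the range of `Φ`. As `Φ` is isometric on a
  -- complete space, this range is closed, and monomials suffice.
  have hΦ : Isometry Φ := by
    refine AddMonoidHomClass.isometry_of_norm Φ fun a => ?_
    change max ‖ρ a‖ ‖ρ (star (S.σ k⁻¹ g⁻¹ : A) * S.α k⁻¹ a)‖ = ‖a‖
    rw [NonUnitalStarAlgHom.norm_map ρ hρ, max_eq_left]
    refine (NonUnitalStarAlgHom.norm_apply_le ρ _).trans ((norm_mul_le _ _).trans ?_)
    rw [norm_star]
    exact (mul_le_of_le_one_left (norm_nonneg _) (norm_unitary_le_one _)).trans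
      (NonUnitalStarAlgHom.norm_apply_le (S.α k⁻¹) a)
  let F := (matrixEntry (K := K) g 1).prod (matrixEntry (g * k) k)
  have hcl : IsClosed (Φ.range.comap F.toLinearMap :
      Set (EllTwo G K →L[ℂ] EllTwo G K)) := by
    have h : IsClosed (Set.range Φ) := hΦ.isClosedEmbedding.isClosed_range
    exact h.preimage F.continuous
  rw [reducedCrossedProduct_eq_top] at hT
  suffices hm : ∀ b : A, ∀ l ∈ (⊤ : Subgroup G),
      S.piHom ρ b * S.lambda ρ l ∈ Φ.range.comap F.toLinearMap by
    obtain ⟨a, ha⟩ := S.mem_of_monomial_mem ρ _ hcl hm hT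
    exact ⟨a, (congrArg Prod.fst ha).symm, (congrArg Prod.snd ha).symm⟩
  · intro b l _
    by_cases hl : g = l
    · subst hl
      refine ⟨S.α g⁻¹ b * (S.σ g⁻¹ g : A), Prod.ext ?_ ?_⟩
      · have h := S.matrixEntry_monomial ρ b g 1
        rw [mul_one] at h
        exact h.symm
      · refine Eq.trans ?_ (S.matrixEntry_monomial ρ b g k).symm
        -- The cocycle identity at this triple converts the entry in column `1` into the entry in
        -- column `k`.
        have h := S.cocycle k⁻¹ g⁻¹ g
        rw [inv_mul_cancel, S.σ_one_right, OneMemClass.coe_one, mul_one] at h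
        change ρ _ = ρ _
        rw [map_mul (S.α k⁻¹), S.α_comp, ← h, mul_inv_rev]
        congr 1
        simp only [← mul_assoc]
        rw [Unitary.coe_star_mul_self, one_mul, mul_assoc (S.α _ b), Unitary.coe_star_mul_self,
          mul_one]
    · refine ⟨0, Prod.ext ?_ ?_⟩
      · refine Eq.trans ?_ (S.matrixEntry_monomial_of_ne ρ b (by rwa [mul_one])).symm
        change ρ 0 = 0
        exact map_zero ρ
      · refine Eq.trans ?_ (S.matrixEntry_monomial_of_ne ρ b fun h => hl (mul_right_cancel h)).symm
        change ρ (_ * S.α k⁻¹ 0) = 0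
        rw [map_zero, mul_zero, map_zero]

theorem eq_zero_of_matrixEntry (hρ : Function.Injective ρ) {T : EllTwo G K →L[ℂ] EllTwo G K}
    (hT : T ∈ S.reducedCrossedProduct ρ) (h : ∀ g, matrixEntry g 1 T = 0) : T = 0 := by
  refine ext_matrixEntry fun g k => ?_
  obtain ⟨a, ha, hak⟩ := S.exists_matrixEntry_eq hρ hT (g * k⁻¹) k
  rw [h, eq_comm, ← map_zero ρ] at ha
  rw [inv_mul_cancel_right, hρ ha, map_zero, mul_zero, map_zero] at hak
  rw [hak, map_zero]

/-- For an outer action on a simple algebra, `A` has trivial relative commutant in the crossed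
product. -/
theorem exists_eq_algebraMap_of_commute [IsSimpleRing A] (hS : S.IsOuter)
    (hρ : Function.Injective ρ) {T : EllTwo G K →L[ℂ] EllTwo G K}
    (hT : T ∈ S.reducedCrossedProduct ρ) (hc : ∀ a, T * S.piHom ρ a = S.piHom ρ a * T) :
    ∃ z : ℂ, T = algebraMap ℂ _ z := by
  -- Comparing the entries at `(g, 1)` of `T π_α(a)` and `π_α(a) T` turns commutation into an
  -- intertwining relation in `A`.
  have key : ∀ g, ∃ x : A, matrixEntry g 1 T = ρ x ∧ ∀ a, x * a = S.α g⁻¹ a * x := fun g => by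
    obtain ⟨x, hx, -⟩ := S.exists_matrixEntry_eq hρ hT g 1
    refine ⟨x, hx, fun a => hρ ?_⟩
    rw [map_mul, map_mul, ← hx, ← matrixEntry_mul_piHom, hc, matrixEntry_piHom_mul]
  obtain ⟨x, hx, hxa⟩ := key 1
  obtain ⟨z, rfl⟩ := exists_eq_algebraMap_of_central x fun a => by
    rw [hxa, inv_one, α_one]
  refine ⟨z, sub_eq_zero.1 (S.eq_zero_of_matrixEntry hρ
    (sub_mem hT (algebraMap_mem _ z)) fun g => ?_)⟩
  have hz : (algebraMap ℂ (EllTwo G K →L[ℂ] EllTwo G K) z)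
      = S.piHom ρ (algebraMap ℂ A z) * S.lambda ρ 1 := by
    rw [lambda_one, mul_one]
    exact ((S.piHom ρ).toAlgHom.commutes z).symm
  rw [map_sub, hz]
  by_cases hg : g = 1
  · subst hg
    have h := S.matrixEntry_monomial ρ (algebraMap ℂ A z) 1 1
    rw [mul_one] at h
    rw [h, hx, inv_one, α_one, S.σ_one_left, OneMemClass.coe_one, mul_one, sub_self]
  · rw [matrixEntry_monomial_of_ne _ _ _ (by rwa [mul_one]), sub_zero]
    obtain ⟨y, hy, hya⟩ := key g
    rw [hy]
    by_contra hne
    exact hS g⁻¹ (inv_ne_one.2 hg) (exists_unitary_of_intertwiner (S.α g⁻¹) y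
      (fun h => hne (by rw [h, map_zero])) hya)

/-- The unitary `λ_g`, up to a factor in `A`, lies in the crossed product by `H` only for
`g ∈ H`. -/
theorem mem_of_lambda_mem [Nontrivial A] (hρ : Function.Injective ρ) {H : Subgroup G} {a : A}
    (ha : IsUnit a) {g : G} (h : S.piHom ρ a * S.lambda ρ g ∈ S.reducedCrossedProductOn ρ H) :
    g ∈ H := by
  by_contra hg
  -- For `g ∉ H` the entry at `(g, 1)` kills all monomials over `H`, but on `π_α(a) λ_g` it is the
  -- image of a unit.
  have hcl : IsClosed (LinearMap.ker (matrixEntry (K := K) g 1).toLinearMap :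
      Set (EllTwo G K →L[ℂ] EllTwo G K)) := ContinuousLinearMap.isClosed_ker _
  have h0 := S.mem_of_monomial_mem ρ _ hcl (fun b l hl =>
    S.matrixEntry_monomial_of_ne ρ b (by rw [mul_one]; rintro rfl; exact hg hl)) h
  have h1 := S.matrixEntry_monomial ρ a g 1
  rw [mul_one] at h1
  have h2 := h1.symm.trans h0
  rw [← map_zero ρ] at h2
  have h3 : IsUnit (S.α g⁻¹ a * (S.σ g⁻¹ g : A)) :=
    (ha.map (S.α g⁻¹)).mul (Unitary.isUnit_coe (U := S.σ g⁻¹ g))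
  rw [hρ h2] at h3
  exact not_isUnit_zero h3

end TwistedAction

/-! ### Conditional expectations. -/

section Inclusions

variable {D : Type*} [CStarAlgebra D] {B C : StarSubalgebra ℂ D} {hBC : B ≤ C} {E : C →ₗ[ℂ] B}

theorem IsConditionalExpectation.map_one (hE : IsConditionalExpectation hBC E) : E 1 = 1 :=
  hE.map_inclusion 1

theorem IsConditionalExpectation.map_star (hE : IsConditionalExpectation hBC E) (c : C) :
    E (star c) = star (E c) := by
  have hsa : ∀ d : C, star (E (star d * d)) = E (star d * d) := fun d => by
    obtain ⟨b, hb⟩ := hE.map_positive d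
    rw [hb, star_mul, star_star]
  -- Polarization: the self-adjointness of `E(d* d)` at `d = c`, `c + 1` and `c + i` isolates
  -- `E(c*)`.
  have h0 := hsa c
  have h1 := hsa (c + 1)
  have h2 := hsa (c + Complex.I • 1)
  have e1 : star (c + 1) * (c + 1) = star c * c + star c + c + 1 := by
    rw [star_add, star_one]; noncomm_ring
  have e2 : star (c + Complex.I • 1) * (c + Complex.I • 1)
      = star c * c + Complex.I • star c - Complex.I • c + 1 := by
    simp only [star_add, star_smul, star_one, add_mul, mul_add, smul_mul_assoc, mul_smul_comm,
      mul_one, one_mul, RCLike.star_def, Complex.conj_I]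
    match_scalars <;> ring_nf <;> simp
  rw [e1] at h1
  rw [e2] at h2
  simp only [map_add, map_sub, map_smul, star_add, star_sub, star_smul, hE.map_one, star_one, h0,
    add_left_inj, RCLike.star_def, Complex.conj_I] at h1 h2
  have h1' : star (E (star c)) + star (E c) = E (star c) + E c := by
    rw [add_assoc, add_assoc] at h1
    exact add_left_cancel h1
  have h2' : Complex.I • (star (E c) - star (E (star c))) = Complex.I • (E (star c) - E c) := by
    rw [add_sub_assoc, add_sub_assoc] at h2
    have := add_left_cancel h2
    rw [smul_sub, smul_sub, ← this]
    module
  have h3 := smul_right_injective B Complex.I_ne_zero h2'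
  have h4 : (2 : ℂ) • E (star c) = (2 : ℂ) • star (E c) := by
    have e3 : (2 : ℂ) • E (star c) = (E (star c) + E c) + (E (star c) - E c) := by module
    rw [e3, ← h1', ← h3]
    module
  exact smul_right_injective B two_ne_zero h4

/-- The kernel of a conditional expectation keeps away from `1`. -/
theorem IsConditionalExpectation.half_lt_norm_one_sub [Nontrivial D]
    (hE : IsConditionalExpectation hBC E) (hC : IsClosed (C : Set D)) {c : C} (hc : E c = 0) :
    1 / 2 < ‖1 - (c : D)‖ := by
  by_contra! hle
  let _ : IsClosed (C : Set D) := hC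
  let _ := CStarAlgebra.spectralOrder C
  have _ := CStarAlgebra.spectralOrderedRing C
  -- If `‖1 - c‖ ≤ 1/2`, then `‖s‖ ≤ 1` and `1 + s ≥ 0`; yet `E c = 0` gives `E(1 + s) = 1 - 2 =
  -- -1`. Thus positivity of `E` suffices, without contractivity.
  let s : C := -((1 - c) + star (1 - c))
  have hs : IsSelfAdjoint s := (IsSelfAdjoint.add_star_self (1 - c)).neg
  have hn : ‖s‖ ≤ 1 := by
    rw [norm_neg]
    refine (norm_add_le _ _).trans ?_
    rw [norm_star]
    have : ‖1 - c‖ ≤ 1 / 2 := hle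
    linarith
  have hpos : 0 ≤ 1 + s := by
    have h1 := hs.neg_algebraMap_norm_le_self
    have h2 : algebraMap ℝ C ‖s‖ ≤ algebraMap ℝ C 1 := algebraMap_mono C hn
    rw [_root_.map_one] at h2
    exact neg_le_iff_add_nonneg'.1 ((neg_le_neg h2).trans h1)
  obtain ⟨y, hy⟩ := CStarAlgebra.nonneg_iff_eq_star_mul_self.1 hpos
  obtain ⟨b, hb⟩ := hE.map_positive y
  rw [← hy] at hb
  have hE1 : E (1 + s) = -1 := by
    simp only [s, _root_.map_add, map_neg, map_sub, star_sub, star_one, hE.map_one,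
      hE.map_star, hc, star_zero]
    norm_num
  rw [hE1] at hb
  let _ := CStarAlgebra.spectralOrder D
  have _ := CStarAlgebra.spectralOrderedRing D
  have hbD : (-1 : D) = star (b : D) * b := congrArg Subtype.val hb
  have h1 : (0 : D) ≤ -1 := hbD ▸ star_mul_self_nonneg (b : D)
  have h2 : (0 : D) ≤ 1 := by simp
  exact one_ne_zero (le_antisymm (neg_nonneg.1 h1) h2)

end Inclusions

/-! ### Unitary normalizers and the normalizer of the subgroup. -/

namespace TwistedAction

variable {A : Type*} {G : Type*} {K : Type*} [CStarAlgebra A] [Group G]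
  [NormedAddCommGroup K] [InnerProductSpace ℂ K] [CompleteSpace K]
  (S : TwistedAction A G) {ρ : A →⋆ₐ[ℂ] (K →L[ℂ] K)}

/-- The conjugate is `λ_{g h g⁻¹}` times a unit of `A`, so `mem_of_lambda_mem` decides membership.
-/
theorem lambda_conj_lambda_mem_iff [Nontrivial A] (hρ : Function.Injective ρ) (H : Subgroup G)
    (g h : G) : S.lambda ρ g * S.lambda ρ h * star (S.lambda ρ g) ∈
      S.reducedCrossedProductOn ρ H ↔ g * h * g⁻¹ ∈ H := by
  have key : S.lambda ρ g * S.lambda ρ h * star (S.lambda ρ g) =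
      S.piHom ρ ((S.σ g h : A) * S.α (g * h) (star (S.σ g⁻¹ g : A)) * (S.σ (g * h) g⁻¹ : A)) *
        S.lambda ρ (g * h * g⁻¹) := by
    rw [lambda_mul_lambda, star_lambda, mul_assoc, ← mul_assoc (S.lambda ρ (g * h)),
      lambda_mul_piHom, mul_assoc, lambda_mul_lambda]
    simp only [map_mul, mul_assoc]
  rw [key]
  refine ⟨fun hm => S.mem_of_lambda_mem hρ ?_ hm,
    fun hm => mul_mem (S.piHom_mem ρ H _) (S.lambda_mem ρ hm)⟩
  refine ((Unitary.isUnit_coe (U := S.σ g h)).mul ?_).mul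
    (Unitary.isUnit_coe (U := S.σ (g * h) g⁻¹))
  exact (Unitary.isUnit_coe (U := S.σ g⁻¹ g)).star.map (S.α (g * h))

theorem star_lambda_conj_lambda_mem_iff [Nontrivial A] (hρ : Function.Injective ρ)
    (H : Subgroup G) (g h : G) : star (S.lambda ρ g) * S.lambda ρ h * S.lambda ρ g ∈
      S.reducedCrossedProductOn ρ H ↔ g⁻¹ * h * g ∈ H := by
  have key : star (S.lambda ρ g) * S.lambda ρ h * S.lambda ρ g =
      S.piHom ρ (star (S.σ g⁻¹ g : A) * (S.σ g⁻¹ h : A) * (S.σ (g⁻¹ * h) g : A)) *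
        S.lambda ρ (g⁻¹ * h * g) := by
    rw [star_lambda, mul_assoc (S.piHom ρ _), lambda_mul_lambda, mul_assoc, mul_assoc,
      lambda_mul_lambda]
    simp only [map_mul, mul_assoc]
  rw [key]
  refine ⟨fun hm => S.mem_of_lambda_mem hρ ?_ hm,
    fun hm => mul_mem (S.piHom_mem ρ H _) (S.lambda_mem ρ hm)⟩
  exact ((Unitary.isUnit_coe (U := S.σ g⁻¹ g)).star.mul (Unitary.isUnit_coe (U := S.σ g⁻¹ h))).mul
    (Unitary.isUnit_coe (U := S.σ (g⁻¹ * h) g))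

/-- If all the `E(u λ_g*)` vanish, then `E` vanishes on a dense subspace of `u C`. -/
theorem exists_condExp_ne_zero [Nontrivial A] (hρ : Function.Injective ρ) {H : Subgroup G}
    {E : S.reducedCrossedProduct ρ →ₗ[ℂ] S.reducedCrossedProductOn ρ H}
    (hE : IsConditionalExpectation (S.reducedCrossedProductOn_le ρ H) E)
    (u : S.reducedCrossedProduct ρ)
    (hu : (u : EllTwo G K →L[ℂ] EllTwo G K) ∈ unitary (EllTwo G K →L[ℂ] EllTwo G K)) :
    ∃ g, E (u * star ⟨S.lambda ρ g, S.lambda_mem_reducedCrossedProduct ρ g⟩) ≠ 0 := by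
  by_contra! h0
  have hspan : ∀ T ∈ Submodule.span ℂ (S.monomials ρ ⊤),
      ∃ c : S.reducedCrossedProduct ρ, (c : EllTwo G K →L[ℂ] EllTwo G K) = u * T ∧ E c = 0 := by
    intro T hT
    induction hT using Submodule.span_induction with
    | zero => exact ⟨0, by simp, map_zero E⟩
    | add x y _ _ hx hy =>
      obtain ⟨c, hc, hc0⟩ := hx
      obtain ⟨d, hd, hd0⟩ := hy
      exact ⟨c + d, by rw [mul_add, ← hc, ← hd]; rfl, by rw [map_add, hc0, hd0, add_zero]⟩
    | smul z x _ hx =>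
      obtain ⟨c, hc, hc0⟩ := hx
      exact ⟨z • c, by rw [mul_smul_comm, ← hc]; rfl, by rw [map_smul, hc0, smul_zero]⟩
    | mem x hx =>
      obtain ⟨a, g, -, rfl⟩ := hx
      -- This element lies in `π_α(A)`, so each monomial is `λ_{g⁻¹}*` times an element of `B`, and
      -- `E` can pull that factor out.
      have hb : S.lambda ρ g⁻¹ * (S.piHom ρ a * S.lambda ρ g) ∈ S.reducedCrossedProductOn ρ H := by
        rw [← mul_assoc, lambda_mul_piHom, mul_assoc, lambda_mul_lambda, inv_mul_cancel,
          lambda_one, mul_one]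
        exact mul_mem (S.piHom_mem ρ H _) (S.piHom_mem ρ H _)
      have h := hE.map_mul_right
        (u * star ⟨S.lambda ρ g⁻¹, S.lambda_mem_reducedCrossedProduct ρ g⁻¹⟩) ⟨_, hb⟩
      rw [h0, zero_mul] at h
      refine ⟨_, ?_, h⟩
      change (u : EllTwo G K →L[ℂ] EllTwo G K) * star (S.lambda ρ g⁻¹) *
        (S.lambda ρ g⁻¹ * (S.piHom ρ a * S.lambda ρ g)) = _
      rw [mul_assoc, ← mul_assoc (star _), star_lambda_mul_lambda, one_mul]
  have : Nontrivial (K →L[ℂ] K) := hρ.nontrivial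
  have : Nontrivial K := by
    by_contra hK
    rw [not_nontrivial_iff_subsingleton] at hK
    exact not_subsingleton (K →L[ℂ] K) inferInstance
  have : Nontrivial (EllTwo G K →L[ℂ] EllTwo G K) := by
    refine ⟨S.piHom ρ 1, 0, fun h => ?_⟩
    have h1 := S.matrixEntry_monomial ρ 1 1 1
    rw [h, zero_mul, map_zero, mul_one, inv_one, α_one, S.σ_one_left, OneMemClass.coe_one,
      mul_one, map_one] at h1
    exact zero_ne_one h1
  have hstar : star (u : EllTwo G K →L[ℂ] EllTwo G K) ∈ S.reducedCrossedProductOn ρ ⊤ := by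
    rw [← reducedCrossedProduct_eq_top]
    exact star_mem u.2
  -- With `T` within `1/2` of `u*`, `u T` lies in the kernel of `E` and within `1/2` of `1`, which
  -- `half_lt_norm_one_sub` excludes.
  obtain ⟨T, hT, hd⟩ := Metric.mem_closure_iff.1 (S.mem_closure_span_monomials ρ hstar) (1 / 2)
    (by norm_num)
  obtain ⟨c, hc, hc0⟩ := hspan T hT
  have hlt := hE.half_lt_norm_one_sub (StarSubalgebra.isClosed_topologicalClosure _) hc0
  refine hlt.not_ge ?_
  rw [hc, ← hu.2, ← mul_sub]
  rw [dist_eq_norm] at hd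
  exact (norm_mul_le _ _).trans
    ((mul_le_of_le_one_left (norm_nonneg _) (norm_unitary_le_one ⟨_, hu⟩)).trans hd.le)

/-- A unitary that normalizes the crossed product by `H` is, up to a factor in that algebra, one
of the `λ_g`. -/
theorem exists_mul_star_lambda_mem [IsSimpleRing A] (hS : S.IsOuter)
    (hρ : Function.Injective ρ) {H : Subgroup G}
    {E : S.reducedCrossedProduct ρ →ₗ[ℂ] S.reducedCrossedProductOn ρ H}
    (hE : IsConditionalExpectation (S.reducedCrossedProductOn_le ρ H) E)
    {u : EllTwo G K →L[ℂ] EllTwo G K}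
    (hu : u ∈ unitaryNormalizer (S.reducedCrossedProductOn ρ H) (S.reducedCrossedProduct ρ)) :
    ∃ g, u * star (S.lambda ρ g) ∈ S.reducedCrossedProductOn ρ H := by
  obtain ⟨huC, huU, huB⟩ := hu
  obtain ⟨g, hg⟩ := S.exists_condExp_ne_zero hρ hE ⟨u, huC⟩ huU
  refine ⟨g, ?_⟩
  set x := E (⟨u, huC⟩ * star ⟨S.lambda ρ g, S.lambda_mem_reducedCrossedProduct ρ g⟩)
  have hθ : ∀ a, u * S.piHom ρ a * star u ∈ S.reducedCrossedProductOn ρ H := fun a => by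
    have := Set.mem_image_of_mem (fun b => u * b * star u) (S.piHom_mem ρ H a)
    rwa [show _ = _ from huB] at this
  have hint : ∀ a, u * S.piHom ρ a * star u * (x : EllTwo G K →L[ℂ] EllTwo G K)
      = x * S.piHom ρ (S.α g a) := fun a => by
    have h1 := hE.map_mul_left ⟨_, hθ a⟩
      (⟨u, huC⟩ * star ⟨S.lambda ρ g, S.lambda_mem_reducedCrossedProduct ρ g⟩)
    have h2 := hE.map_mul_right
      (⟨u, huC⟩ * star ⟨S.lambda ρ g, S.lambda_mem_reducedCrossedProduct ρ g⟩)
      ⟨_, S.piHom_mem ρ H (S.α g a)⟩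
    refine congrArg Subtype.val ((h1.symm.trans (congrArg E ?_)).trans h2)
    refine Subtype.ext ?_
    change u * S.piHom ρ a * star u * (u * star (S.lambda ρ g))
      = u * star (S.lambda ρ g) * S.piHom ρ (S.α g a)
    rw [mul_assoc u (star _), star_lambda_mul_piHom, mul_assoc, ← mul_assoc (star u), huU.1,
      one_mul, mul_assoc]
  have hint' : ∀ a, star (x : EllTwo G K →L[ℂ] EllTwo G K) * (u * S.piHom ρ a)
      = S.piHom ρ (S.α g a) * star (x : EllTwo G K →L[ℂ] EllTwo G K) * u := fun a => by
    have h := congrArg star (hint (star a))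
    simp only [star_mul, star_star, ← map_star] at h
    rw [← h]
    simp only [mul_one, mul_assoc, huU.1]
  -- By `hint'`, moving `π_α(a)` across `x* u` applies `α_g`, and moving it across `λ_g*` undoes
  -- this.
  obtain ⟨z, hz⟩ := S.exists_eq_algebraMap_of_commute hS hρ
    (T := star (S.lambda ρ g) * star (x : EllTwo G K →L[ℂ] EllTwo G K) * u)
    (mul_mem (mul_mem (star_mem (S.lambda_mem_reducedCrossedProduct ρ g))
      (star_mem (S.reducedCrossedProductOn_le ρ H x.2))) huC)
    (fun a => by
      rw [mul_assoc, mul_assoc, hint', mul_assoc, ← mul_assoc, star_lambda_mul_piHom]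
      simp only [mul_assoc])
  have hxz : (x : EllTwo G K →L[ℂ] EllTwo G K) = star z • (u * star (S.lambda ρ g)) := by
    have h1 : star (x : EllTwo G K →L[ℂ] EllTwo G K) = z • (S.lambda ρ g * star u) := by
      have h := congrArg (fun y => S.lambda ρ g * y * star u) hz
      simp only [← mul_assoc, lambda_mul_star_lambda, one_mul] at h
      rw [mul_assoc, huU.2, mul_one] at h
      rw [h, Algebra.algebraMap_eq_smul_one, mul_smul_comm, smul_mul_assoc, mul_one]
    rw [← star_star (x : EllTwo G K →L[ℂ] EllTwo G K), h1, star_smul, star_mul, star_star]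
  have hz0 : star z ≠ 0 := fun h => hg (Subtype.ext (by rw [hxz, h, zero_smul]; rfl))
  rw [← inv_smul_smul₀ hz0 (u * star (S.lambda ρ g)), ← hxz]
  exact SMulMemClass.smul_mem _ x.2

/-- Conjugation by `λ_g` and by `u` differ by conjugation by the unitary `u λ_g*` of `B`, so `λ_g`
normalizes `B` as `u` does. Applied to the `λ_h`, this yields the condition on `H`. -/
theorem mem_normalizer_of_conj [Nontrivial A] (hρ : Function.Injective ρ) {H : Subgroup G}
    {u : EllTwo G K →L[ℂ] EllTwo G K}
    (hu : u ∈ unitaryNormalizer (S.reducedCrossedProductOn ρ H) (S.reducedCrossedProduct ρ))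
    {g : G} (hg : u * star (S.lambda ρ g) ∈ S.reducedCrossedProductOn ρ H) :
    g ∈ Subgroup.normalizer (H : Set G) := by
  obtain ⟨-, huU, huB⟩ := hu
  have hg' : S.lambda ρ g * star u ∈ S.reducedCrossedProductOn ρ H := by
    have := star_mem hg
    rwa [star_mul, star_star] at this
  rw [Subgroup.mem_normalizer_iff]
  refine fun h => ⟨fun hh => ?_, fun hh => ?_⟩
  · rw [← S.lambda_conj_lambda_mem_iff hρ]
    have h1 : u * S.lambda ρ h * star u ∈ S.reducedCrossedProductOn ρ H := by
      have := Set.mem_image_of_mem (fun b => u * b * star u) (S.lambda_mem ρ hh)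
      rwa [show _ = _ from huB] at this
    have h2 := mul_mem (mul_mem hg' h1) hg
    have h3 : S.lambda ρ g * star u * (u * S.lambda ρ h * star u) * (u * star (S.lambda ρ g))
        = S.lambda ρ g * (star u * u) * S.lambda ρ h * (star u * u) * star (S.lambda ρ g) := by
      simp only [mul_assoc]
    rwa [h3, huU.1, mul_one, mul_one] at h2
  · have h1 := mul_mem (mul_mem hg (S.lambda_mem ρ hh)) hg'
    have h2 : u * star (S.lambda ρ g) * S.lambda ρ (g * h * g⁻¹) * (S.lambda ρ g * star u)
        ∈ (fun b => u * b * star u) ''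
          (S.reducedCrossedProductOn ρ H : Set (EllTwo G K →L[ℂ] EllTwo G K)) := by
      rw [show _ = _ from huB]
      exact h1
    obtain ⟨b, hb, hbu⟩ := h2
    have h3 : b = star (S.lambda ρ g) * S.lambda ρ (g * h * g⁻¹) * S.lambda ρ g := by
      have h := congrArg (fun y => star u * y * u) hbu
      simp only [mul_assoc, huU.1, mul_one] at h
      simp only [← mul_assoc, huU.1, one_mul] at h
      exact h
    rw [SetLike.mem_coe, h3, star_lambda_conj_lambda_mem_iff S hρ] at hb
    simpa [mul_assoc] using hb

/-- Checked on monomials. Both directions are needed because the unitary normalizer requires `u B u*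
= B`, not just an inclusion. -/
theorem lambda_conj_mem {H : Subgroup G} (hH : H.Normal) (hρ : Function.Injective ρ)
    [Nontrivial A] (g : G) {b : EllTwo G K →L[ℂ] EllTwo G K}
    (hb : b ∈ S.reducedCrossedProductOn ρ H) :
    S.lambda ρ g * b * star (S.lambda ρ g) ∈ S.reducedCrossedProductOn ρ H ∧
      star (S.lambda ρ g) * b * S.lambda ρ g ∈ S.reducedCrossedProductOn ρ H := by
  let F : (EllTwo G K →L[ℂ] EllTwo G K) →ₗ[ℂ] (EllTwo G K →L[ℂ] EllTwo G K) :=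
    LinearMap.mulRight ℂ (star (S.lambda ρ g)) ∘ₗ LinearMap.mulLeft ℂ (S.lambda ρ g)
  let F' : (EllTwo G K →L[ℂ] EllTwo G K) →ₗ[ℂ] (EllTwo G K →L[ℂ] EllTwo G K) :=
    LinearMap.mulRight ℂ (S.lambda ρ g) ∘ₗ LinearMap.mulLeft ℂ (star (S.lambda ρ g))
  have hF : Continuous F := by
    change Continuous fun x => S.lambda ρ g * x * star (S.lambda ρ g)
    fun_prop
  have hF' : Continuous F' := by
    change Continuous fun x => star (S.lambda ρ g) * x * S.lambda ρ g
    fun_prop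
  let P := Subalgebra.toSubmodule (S.reducedCrossedProductOn ρ H).toSubalgebra
  have hP : IsClosed (P : Set (EllTwo G K →L[ℂ] EllTwo G K)) :=
    S.isClosed_reducedCrossedProductOn ρ H
  constructor
  · refine S.mem_of_monomial_mem ρ (P.comap F) (hP.preimage hF) (fun a h hh => ?_) hb
    change S.lambda ρ g * (S.piHom ρ a * S.lambda ρ h) * star (S.lambda ρ g) ∈
      S.reducedCrossedProductOn ρ H
    rw [← mul_assoc, lambda_mul_piHom, mul_assoc, mul_assoc, ← mul_assoc (S.lambda ρ g)]
    exact mul_mem (S.piHom_mem ρ H _)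
      ((S.lambda_conj_lambda_mem_iff hρ H g h).2 (hH.conj_mem h hh g))
  · refine S.mem_of_monomial_mem ρ (P.comap F') (hP.preimage hF') (fun a h hh => ?_) hb
    change star (S.lambda ρ g) * (S.piHom ρ a * S.lambda ρ h) * S.lambda ρ g ∈
      S.reducedCrossedProductOn ρ H
    obtain ⟨b, rfl⟩ : ∃ b, S.α g b = a := (S.α g).surjective a
    rw [← mul_assoc, star_lambda_mul_piHom, mul_assoc, mul_assoc, ← mul_assoc (star _)]
    refine mul_mem (S.piHom_mem ρ H _) ((S.star_lambda_conj_lambda_mem_iff hρ H g h).2 ?_)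
    simpa using hH.conj_mem h hh g⁻¹

theorem lambda_mem_unitaryNormalizer {H : Subgroup G} (hH : H.Normal)
    (hρ : Function.Injective ρ) [Nontrivial A] (g : G) :
    S.lambda ρ g ∈ unitaryNormalizer (S.reducedCrossedProductOn ρ H)
      (S.reducedCrossedProduct ρ) := by
  refine ⟨S.lambda_mem_reducedCrossedProduct ρ g, S.lambda_mem_unitary ρ g,
    Set.Subset.antisymm ?_ fun b hb => ?_⟩
  · rintro _ ⟨b, hb, rfl⟩
    exact (S.lambda_conj_mem hH hρ g hb).1
  · refine ⟨_, (S.lambda_conj_mem hH hρ g hb).2, ?_⟩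
    have h : S.lambda ρ g * (star (S.lambda ρ g) * b * S.lambda ρ g) * star (S.lambda ρ g)
        = S.lambda ρ g * star (S.lambda ρ g) * b * (S.lambda ρ g * star (S.lambda ρ g)) := by
      simp only [mul_assoc]
    simp only [h, lambda_mul_star_lambda, one_mul, mul_one]

theorem piHom_mem_unitaryNormalizer (H : Subgroup G) {u : A} (hu : u ∈ unitary A) :
    S.piHom ρ u ∈ unitaryNormalizer (S.reducedCrossedProductOn ρ H)
      (S.reducedCrossedProduct ρ) := by
  have hm : ∀ a, S.piHom ρ a ∈ S.reducedCrossedProductOn ρ H := S.piHom_mem ρ H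
  have h1 : S.piHom ρ u * S.piHom ρ (star u) = 1 := by rw [← map_mul, hu.2, map_one]
  refine ⟨S.reducedCrossedProductOn_le ρ H (hm u), Unitary.map_mem (S.piHom ρ) hu,
    Set.Subset.antisymm ?_ fun b hb => ?_⟩
  · rintro _ ⟨b, hb, rfl⟩
    exact mul_mem (mul_mem (hm u) hb) (star_mem (hm u))
  · refine ⟨S.piHom ρ (star u) * b * S.piHom ρ u, mul_mem (mul_mem (hm _) hb) (hm u), ?_⟩
    have h : S.piHom ρ u * (S.piHom ρ (star u) * b * S.piHom ρ u) * star (S.piHom ρ u)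
        = S.piHom ρ u * S.piHom ρ (star u) * b * (S.piHom ρ u * S.piHom ρ (star u)) := by
      simp only [mul_assoc, map_star]
    simp only [h, h1, one_mul, mul_one]

theorem isRegularInclusion_of_normal [Nontrivial A] (hρ : Function.Injective ρ) {H : Subgroup G}
    (hH : H.Normal) :
    IsRegularInclusion (S.reducedCrossedProductOn ρ H) (S.reducedCrossedProduct ρ) := by
  refine le_antisymm (StarSubalgebra.topologicalClosure_minimal
    (StarAlgebra.adjoin_le fun u hu => hu.1) (StarSubalgebra.isClosed_topologicalClosure _)) ?_
  refine StarSubalgebra.topologicalClosure_mono (StarAlgebra.adjoin_le ?_)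
  rintro _ (⟨a, rfl⟩ | ⟨g, rfl⟩)
  · have ha : a ∈ Submodule.span ℂ (unitary A : Set A) := by
      rw [CStarAlgebra.span_unitary]
      trivial
    change S.piHom ρ a ∈ StarAlgebra.adjoin ℂ _
    induction ha using Submodule.span_induction with
    | zero => rw [map_zero]; exact zero_mem _
    | add x y _ _ hx hy => rw [map_add]; exact add_mem hx hy
    | smul z x _ hx => rw [map_smul]; exact SMulMemClass.smul_mem _ hx
    | mem x hx => exact StarAlgebra.subset_adjoin ℂ _ (S.piHom_mem_unitaryNormalizer H hx)
  · exact StarAlgebra.subset_adjoin ℂ _ (S.lambda_mem_unitaryNormalizer hH hρ g)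

theorem normal_of_isRegularInclusion [IsSimpleRing A] (hS : S.IsOuter)
    (hρ : Function.Injective ρ) {H : Subgroup G}
    {E : S.reducedCrossedProduct ρ →ₗ[ℂ] S.reducedCrossedProductOn ρ H}
    (hE : IsConditionalExpectation (S.reducedCrossedProductOn_le ρ H) E)
    (hreg : IsRegularInclusion (S.reducedCrossedProductOn ρ H) (S.reducedCrossedProduct ρ)) :
    H.Normal := by
  -- Each normalizing unitary factors as `(u λ_g*) λ_g` with `g` in the normalizer of `H`, so all of
  -- `C` lives over that normalizer.
  have hle : S.reducedCrossedProduct ρ ≤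
      S.reducedCrossedProductOn ρ (Subgroup.normalizer (H : Set G)) := by
    rw [← show _ = _ from hreg]
    refine StarSubalgebra.topologicalClosure_minimal (StarAlgebra.adjoin_le fun u hu => ?_)
      (S.isClosed_reducedCrossedProductOn ρ _)
    obtain ⟨g, hg⟩ := S.exists_mul_star_lambda_mem hS hρ hE hu
    have hmono : S.reducedCrossedProductOn ρ H ≤
        S.reducedCrossedProductOn ρ (Subgroup.normalizer (H : Set G)) :=
      StarSubalgebra.topologicalClosure_mono (StarAlgebra.adjoin_mono
        (Set.union_subset_union_right _ (Set.image_mono Subgroup.le_normalizer)))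
    have := mul_mem (hmono hg) (S.lambda_mem ρ (S.mem_normalizer_of_conj hρ hu hg))
    rwa [mul_assoc, star_lambda_mul_lambda, mul_one] at this
  rw [← Subgroup.normalizer_eq_top_iff, eq_top_iff]
  intro g _
  refine S.mem_of_lambda_mem hρ isUnit_one ?_
  rw [map_one, one_mul]
  exact hle (S.lambda_mem_reducedCrossedProduct ρ g)

end TwistedAction

theorem mainTheorem4 {A : Type*} {G : Type*} {K : Type*}
    [CStarAlgebra A] [IsSimpleRing A] [Group G]
    [NormedAddCommGroup K] [InnerProductSpace ℂ K] [CompleteSpace K]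
    (S : TwistedAction A G) (hS : S.IsOuter)
    (ρ : A →⋆ₐ[ℂ] (K →L[ℂ] K)) (hρ : Function.Injective ρ)
    (H : Subgroup G)
    (hirr : IsIrreducibleInclusion (S.reducedCrossedProductOn ρ H) (S.reducedCrossedProduct ρ))
    (hE : ∃ E : S.reducedCrossedProduct ρ →ₗ[ℂ] S.reducedCrossedProductOn ρ H,
      IsConditionalExpectation (S.reducedCrossedProductOn_le ρ H) E) :
    IsRegularInclusion (S.reducedCrossedProductOn ρ H) (S.reducedCrossedProduct ρ) ↔
      H.Normal := by
  obtain ⟨E, hE⟩ := hE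
  exact ⟨S.normal_of_isRegularInclusion hS hρ hE, S.isRegularInclusion_of_normal hρ⟩
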